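/- **Setting.** Let $V$ be a finite set of observed variables, $X_v$ taking values in standard Borel spaces. Let $(\mathcal S_a,\mathcal T_a)$ be an admissible testing family: a nonempty family $\mathcal S_a$ of subsets of $V$ and a set $\mathcal T_a$ of queries $(v,Z)$ with $v\notin Z$ and $\{v\}\cup Z\subseteq S'$ for some $S'\in\mathcal S_a$. Let $\mathcal D=(\mathcal D^{(0)},\mathcal D^{(1)})$ be within-regime discovery operators, which map laws on a subset $S'$ to PDAGs on $S'$, and let $\mathcal M$ be a class of two-regime structural causal models with a common DAG in both regimes and modular soft interventions on a target set $I$ in regime $1$. For a model with laws $(P^{(0)},P^{(1)})$ put $E_{S'}^{(c)}=\mathcal D^{(c)}(P_{S'}^{(c)})$. Let $\mathrm{Inv}(v\mid Z)=1$ if $P^{(0)}(X_v\mid X_Z)$ and $P^{(1)}(X_v\mid X_Z)$ have a common version, $\mathrm{Inv}(v\mid Z)=0$ otherwise, and $\mathrm{Chg}=1-\mathrm{Inv}$. The evidence of the model is $\big((E_{S'}^{(c)})_{S'\in\mathcal S_a,c},(\mathrm{Inv}(v\mid Z))_{(v,Z)\in\mathcal T_a}\big)$. For a DAG $G$ on $V$,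 $[G]_{\mathrm{res}}$ is the set of DAGs $G'$ on $V$ such that the models in $\mathcal M$ with DAG $G'$ generate the same set of evidences as those with DAG $G$. The PDAG $G_{\mathrm{test}}(G)$ has the adjacencies and the directed edges common to all $G'\in[G]_{\mathrm{res}}$; its other adjacencies are undirected. Let $\mathcal W(v)$ be the set of $Z$ with $(v,Z)\in\mathcal T_a$ such that some $S'\in\mathcal S_a$ contains $\{v\}\cup Z$ and, for both $c$, $Z$ contains no vertex that is a descendant of $v$ in every DAG extension of $E_{S'}^{(c)}$. Assume regime faithfulness on tested witnesses: for every model in $\mathcal M$, with DAG $G'$ and targets $I'$, and every $(v,Z)\in\mathcal T_a$ with $Z\in\mathcal W(v)$, the vertices $C$ and $v$ are d-separated by $Z$ in the augmented graph $G'^*=G'\cup\{C\to t:t\in I'\}$ if and only if $C$ and $X_v$ are conditionally independent given $X_Z$ under $P^*(C=c,X)=w_cP^{(c)}(X)$, where $w_0,w_1>0$, $w_0+w_1=1$. **Proposition (Contrastive Discriminating Path).** Let a model in $\mathcal M$ with DAG $G$ generate the data, and let $E_{S'}^{(c)}$, $\mathrm{Inv}$, $\mathrm{Chg}$ and $\mathcal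 W$ be those of this model. Let $S\in\mathcal S_a$ and let $\pi=\langle v_0,\dots,v_{m-1},j,k\rangle$ be a common candidate discriminating path on $S$: a simple path in the skeletons of both $E_S^{(0)}$ and $E_S^{(1)}$, with $v_0$ and $k$ non-adjacent in both. Let $j-k$ be undirected in both. Fix ambient local constraints on $S$, that is, a set $\mathcal A$ of DAGs on $S$ (the graphs meeting the constraints) with $G'[S]\in\mathcal A$ for all $G'\in[G]_{\mathrm{res}}$. Let $\mathcal V_{\mathrm{rep}}\subseteq\{v_1,\dots,v_{m-1}\}$. The status of $v_\ell$ in a graph is the pair of bits ($v_\ell$ is a collider on $\pi$, $v_\ell$ is a parent of $k$). A replay assignment is a map $\sigma:\mathcal V_{\mathrm{rep}}\to\{0,1\}^2$; it is compatible if some graph in $\mathcal A$ has these statuses, and then $\mathrm{DP}(\sigma)$ is the mark at $j$ of the edge between $j$ and $k$ (tail: $j\to k$; arrowhead: $k\to j$), if all graphs in $\mathcal A$ with statuses $\sigma$ have this edge with the same mark. Let $\mathcal V_{\mathrm{rep}}$ be sufficient, i.e. $\mathrm{DP}(\sigma)$ is defined for every compatible $\sigma$, and let $\sigma^\star$ be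 a compatible (target) assignment. Let $Z\subseteq S$ be such that $(v,Z)\in\mathcal T_a$ and $Z\in\mathcal W(v)$ for $v=j$ and for all $v\in\mathcal V_{\mathrm{rep}}$, and $$\mathrm{Inv}(v\mid Z)=1\quad\text{for all }v\in\mathcal V_{\mathrm{rep}},\qquad \mathrm{Chg}(j\mid Z)=1.$$ Assume: 1. The edges of $\pi$ are in the skeleton of every $G'\in[G]_{\mathrm{res}}$. 2. Let $G'\in[G]_{\mathrm{res}}$, let $\sigma$ be the assignment given by the statuses in $G'[S]$, and suppose $\mathrm{DP}(\sigma)\ne\mathrm{DP}(\sigma^\star)$. Let $r$ be the first node of $\mathcal V_{\mathrm{rep}}$, in the order from $j$ to $v_0$, with $\sigma(r)\ne\sigma^\star(r)$. Then for every model in $\mathcal M$ with DAG $G'$ and the observed evidence, with augmented graph $G'^*$: (a) the segment of $\pi$ from $r$ to $j$ is in the skeleton of $G'$; (b) under the marks of $\sigma$, every inner node of the segment is unblocked given $Z$; (c) the edge of the segment next to $j$ has a tail at $j$, and $j\notin Z$; (d) if there is an unblocked path from $C$ to $j$ given $Z$ in $G'^*$, then there is one that meets the segment only in $j$. Then there is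 exactly one mark $\mu$ such that: $\mathrm{DP}(\sigma^\star)=\mu$; $\mathrm{DP}(\sigma)=\mu$ and no other mark for every replay assignment $\sigma$ realized in some $G'[S]$, $G'\in[G]_{\mathrm{res}}$; the edge between $j$ and $k$ has the mark $\mu$ at $j$ in $G'[S]$ for every $G'\in[G]_{\mathrm{res}}$; and $G_{\mathrm{test}}(G)$ contains this edge directed accordingly ($j\to k$ if $\mu$ is the tail, $k\to j$ if it is the arrowhead). -/

import Mathlib

open MeasureTheory ProbabilityTheory
open scoped NNReal

/-! ### Directed acyclic graphs and d-separation -/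

/-- A directed acyclic graph on the vertex set `W`. -/
@[ext]
structure DAG (W : Type*) where
  edge : W → W → Prop
  acyclic : ∀ v, ¬ Relation.TransGen edge v v

namespace DAG

variable {W : Type*}

/-- Adjacency in the skeleton. -/
def Adj (D : DAG W) (u v : W) : Prop := D.edge u v ∨ D.edge v u

/-- `v` is a descendant of `u` (every vertex is a descendant of itself). -/
def IsDesc (D : DAG W) (u v : W) : Prop := Relation.ReflTransGen D.edge u v

/-- The induced subgraph `D[S]`. -/
def induce (D : DAG W) (S : Finset W) : DAG S where
  edge u v := D.edge u v
  acyclic v h := D.acyclic v (by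
    have key : ∀ a b : S, Relation.TransGen (fun u v : S => D.edge u v) a b →
        Relation.TransGen D.edge (a : W) (b : W) := by
      intro a b hab
      induction hab with
      | single e => exact .single e
      | tail _ e ih => exact ih.tail e
    exact key v v h)

/-- The vertex in position `i` of the path `q` is a collider on `q` (`1 ≤ i`, and `i` is not the
last position). -/
def IsColliderAt (D : DAG W) (q : ℕ → W) (i : ℕ) : Prop :=
  D.edge (q (i - 1)) (q i) ∧ D.edge (q (i + 1)) (q i)

/-- A vertex `b` that is passed as a collider is unblocked given `Z` if it has a descendant
(possibly itself) in `Z`; one that is passed as a non-collider is unblocked if it is not in `Z`. -/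
def Unblocked (D : DAG W) (Z : Set W) (collider : Prop) (b : W) : Prop :=
  (collider → ∃ d ∈ Z, D.IsDesc b d) ∧ (¬ collider → b ∉ Z)

/-- `⟨q 0, …, q n⟩` is a (simple) path from `a` to `b` that is unblocked given `Z`. -/
structure IsUnblockedPath (D : DAG W) (Z : Set W) (a b : W) (n : ℕ) (q : ℕ → W) : Prop where
  start : q 0 = a
  finish : q n = b
  simple : Set.InjOn q (Set.Iic n)
  adj : ∀ i < n, D.Adj (q i) (q (i + 1))
  unblocked : ∀ i, 0 < i → i < n → D.Unblocked Z (D.IsColliderAt q i) (q i)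

/-- `a` and `b` are d-separated by `Z`. -/
def DSep (D : DAG W) (a b : W) (Z : Set W) : Prop :=
  ¬ ∃ n q, D.IsUnblockedPath Z a b n q

/-- Edges of the augmented graph: the edges of `D`, and `C → t` for `t ∈ I`, where the added
regime vertex `C` is `none`. -/
inductive AugEdge (D : DAG W) (I : Set W) : Option W → Option W → Prop
  | old {u v : W} : D.edge u v → AugEdge D I (some u) (some v)
  | regime {t : W} : t ∈ I → AugEdge D I none (some t)

theorem augEdge_transGen (D : DAG W) (I : Set W) {a b : Option W}
    (h : Relation.TransGen (AugEdge D I) a b) :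
    ∃ v, b = some v ∧ ∀ u, a = some u → Relation.TransGen D.edge u v := by
  induction h with
  | single e =>
    cases e with
    | old e => exact ⟨_, rfl, fun u hu => by cases hu; exact .single e⟩
    | regime e => exact ⟨_, rfl, fun u hu => by cases hu⟩
  | tail _ e ih =>
    obtain ⟨v, rfl, ih⟩ := ih
    cases e with
    | old e => exact ⟨_, rfl, fun u hu => (ih u hu).tail e⟩

/-- The augmented graph `D* = (W ∪ {C}, E ∪ {C → t : t ∈ I})`. -/
def augment (D : DAG W) (I : Set W) : DAG (Option W) where
  edge := AugEdge D I
  acyclic a h := by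
    obtain ⟨v, rfl, hv⟩ := augEdge_transGen D I h
    exact D.acyclic v (hv v rfl)

end DAG

/-! ### Partially directed acyclic graphs -/

/-- A partially directed acyclic graph on `W`. -/
structure PDAG (W : Type*) where
  dir : W → W → Prop
  undir : W → W → Prop
  undir_symm : ∀ u v, undir u v → undir v u
  undir_irrefl : ∀ u, ¬ undir u u
  undir_not_dir : ∀ u v, undir u v → ¬ dir u v
  dir_acyclic : ∀ v, ¬ Relation.TransGen dir v v

namespace PDAG

variable {W : Type*}

/-- Adjacency in the skeleton. -/
def Adj (H : PDAG W) (u v : W) : Prop := H.dir u v ∨ H.dir v u ∨ H.undir u v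

/-- `D` is a DAG extension of `H`: it has the same skeleton, keeps the directed edges, and has no
unshielded collider that is not one of `H`. -/
structure IsExtension (H : PDAG W) (D : DAG W) : Prop where
  skeleton : ∀ u v, D.Adj u v ↔ H.Adj u v
  directed : ∀ u v, H.dir u v → D.edge u v
  colliders : ∀ u v t, u ≠ t → D.edge u v → D.edge t v → ¬ D.Adj u t → H.dir u v ∧ H.dir t v

/-- The definite descendants of `v`: its descendants in every DAG extension of `H`. -/
def definiteDesc (H : PDAG W) (v : W) : Set W :=
  {u | ∀ D, H.IsExtension D → D.IsDesc v u}

end PDAG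

/-! ### Two-regime structural causal models -/

section Model

variable {V : Type*} [Fintype V] [DecidableEq V] (X : V → Type*) [∀ v, MeasurableSpace (X v)]

/-- A two-regime structural causal model with one DAG and modular soft interventions: in regime
`c`, `X_v = f^c_v(X_{pa(v)}, U_v)` with independent noises `U_v`; regime `1` may differ from regime
`0` only in the mechanisms (function or noise law) of the vertices in `targets`. As the graph is
acyclic, the solution map `sol c` is determined by the structural equations. -/
structure TwoRegimeSCM where
  dag : DAG V
  targets : Set V
  U : V → Type
  measU : ∀ v, MeasurableSpace (U v)
  noise : Fin 2 → ∀ v, Measure (U v)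
  noise_prob : ∀ c v, IsProbabilityMeasure (noise c v)
  f : Fin 2 → ∀ v, (∀ u : {u // dag.edge u v}, X u) → U v → X v
  f_meas : ∀ c v, Measurable (fun y : (∀ u : {u // dag.edge u v}, X u) × U v => f c v y.1 y.2)
  noise_modular : ∀ v, v ∉ targets → noise 0 v = noise 1 v
  f_modular : ∀ v, v ∉ targets → f 0 v = f 1 v
  sol : Fin 2 → (∀ v, U v) → ∀ v, X v
  sol_meas : ∀ c, Measurable (sol c)
  sol_eq : ∀ c ω v, sol c ω v = f c v (fun u => sol c ω u) (ω v)

attribute [instance] TwoRegimeSCM.measU TwoRegimeSCM.noise_prob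

variable {X}

/-- The law `P^(c)` of `X_V` in regime `c`. -/
noncomputable def TwoRegimeSCM.law (M : TwoRegimeSCM X) (c : Fin 2) : Measure (∀ v, X v) :=
  (Measure.pi (M.noise c)).map (M.sol c)

instance (M : TwoRegimeSCM X) (c : Fin 2) : IsProbabilityMeasure (M.law c) :=
  Measure.isProbabilityMeasure_map (M.sol_meas c).aemeasurable

/-- `Inv(v | Z) = 1`: the conditional laws of `X_v` given `X_Z` in the two regimes agree, that is,
they have a common version. `Chg(v | Z) = 1` is the negation. -/
def Invariant (P : Fin 2 → Measure (∀ v, X v)) (v : V) (Z : Finset V) : Prop :=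
  ∃ κ : Kernel (∀ u : Z, X u) (X v), IsMarkovKernel κ ∧
    ∀ c, (P c).map (fun x => (Z.restrict x, x v)) = ((P c).map Z.restrict).compProd κ

/-- The law `P*` of `(C, X)` with `P*(C = c, X) = w_c P^(c)(X)`. -/
noncomputable def mixture (w : Fin 2 → ℝ≥0) (P : Fin 2 → Measure (∀ v, X v)) :
    Measure (Fin 2 × ∀ v, X v) :=
  w 0 • (P 0).map (fun x => ((0 : Fin 2), x)) + w 1 • (P 1).map (fun x => ((1 : Fin 2), x))

instance (w : Fin 2 → ℝ≥0) (P : Fin 2 → Measure (∀ v, X v)) [∀ c, IsProbabilityMeasure (P c)] :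
    IsFiniteMeasure (mixture w P) := by
  unfold mixture; infer_instance

/-- `C` and `X_v` are conditionally independent given `X_Z` under `P*`. -/
def RegimeCondIndep [∀ v, StandardBorelSpace (X v)] (w : Fin 2 → ℝ≥0)
    (P : Fin 2 → Measure (∀ v, X v)) [∀ c, IsProbabilityMeasure (P c)] (v : V) (Z : Finset V) :
    Prop :=
  CondIndepFun
    (MeasurableSpace.comap (fun y : Fin 2 × (∀ v, X v) => Z.restrict y.2) inferInstance)
    (Measurable.comap_le ((Finset.measurable_restrict Z).comp measurable_snd))
    (fun y => y.1) (fun y => y.2 v) (mixture w P)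

end Model

/-! ### Restricted evidence, equivalence class, and test-induced essential graph -/

/-- An admissible testing family: admissible subsets and tested invariance queries `(v, Z)`. -/
structure TestingFamily (V : Type*) [DecidableEq V] where
  subsets : Finset (Finset V)
  nonempty : subsets.Nonempty
  tests : Set (V × Finset V)
  not_mem : ∀ v Z, (v, Z) ∈ tests → v ∉ Z
  supported : ∀ v Z, (v, Z) ∈ tests → ∃ S ∈ subsets, insert v Z ⊆ S

section Evidence

variable {V : Type*} [Fintype V] [DecidableEq V] {X : V → Type*} [∀ v, MeasurableSpace (X v)]

variable (X) in
/-- Within-regime discovery operators: for each regime, a map from the laws of the variables in a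
subset `S` to PDAGs on `S`. -/
abbrev Discovery : Type _ := Fin 2 → ∀ S : Finset V, Measure (∀ u : S, X u) → PDAG S

/-- The population local PDAG `E_S^(c)`, computed from the marginal of `P^(c)` on `S`. -/
noncomputable def TwoRegimeSCM.localPDAG (M : TwoRegimeSCM X) (Disc : Discovery X)
    (S : Finset V) (c : Fin 2) : PDAG S :=
  Disc c S ((M.law c).map S.restrict)

/-- The restricted evidence generated by a model: the local PDAGs on the admissible subsets in both
regimes, and the invariance indicators of the tested queries. -/
noncomputable def TwoRegimeSCM.evidence (M : TwoRegimeSCM X) (F : TestingFamily V)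
    (Disc : Discovery X) :
    ((S : F.subsets) → Fin 2 → PDAG (S : Finset V)) × (F.tests → Prop) :=
  (fun S c => M.localPDAG Disc S c, fun t => Invariant M.law t.1.1 t.1.2)

/-- The restricted Psi-image of `G` in the model class `Mod`. -/
def psiImage (Mod : Set (TwoRegimeSCM X)) (F : TestingFamily V) (Disc : Discovery X) (G : DAG V) :
    Set (((S : F.subsets) → Fin 2 → PDAG (S : Finset V)) × (F.tests → Prop)) :=
  {e | ∃ M ∈ Mod, M.dag = G ∧ M.evidence F Disc = e}

/-- The restricted Psi-equivalence class `[G]_res`. -/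
def resClass (Mod : Set (TwoRegimeSCM X)) (F : TestingFamily V) (Disc : Discovery X) (G : DAG V) :
    Set (DAG V) :=
  {G' | psiImage Mod F Disc G' = psiImage Mod F Disc G}

/-- The test-induced essential graph `G_test(G)`: skeleton and orientations are those common to all
members of `[G]_res`; the other edges of the skeleton are undirected. -/
def testGraph (Mod : Set (TwoRegimeSCM X)) (F : TestingFamily V) (Disc : Discovery X) (G : DAG V) :
    PDAG V where
  dir u v := ∀ G' ∈ resClass Mod F Disc G, G'.edge u v
  undir u v := (∀ G' ∈ resClass Mod F Disc G, G'.Adj u v) ∧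
    (¬ ∀ G' ∈ resClass Mod F Disc G, G'.edge u v) ∧
    (¬ ∀ G' ∈ resClass Mod F Disc G, G'.edge v u)
  undir_symm _ _ h := ⟨fun G' hG' => (h.1 G' hG').symm, h.2.2, h.2.1⟩
  undir_irrefl u h := by
    have := h.1 G rfl
    exact G.acyclic u (.single (this.elim id id))
  undir_not_dir _ _ h := h.2.1
  dir_acyclic v h := G.acyclic v (by
    have key : ∀ a b : V,
        Relation.TransGen (fun u v => ∀ G' ∈ resClass Mod F Disc G, G'.edge u v) a b →
        Relation.TransGen G.edge a b := by
      intro a b hab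
      induction hab with
      | single e => exact .single (e G rfl)
      | tail _ e ih => exact ih.tail (e G rfl)
    exact key v v h)

/-- The admissible witness family `W(v)` of a model. -/
def TwoRegimeSCM.witnesses (M : TwoRegimeSCM X) (F : TestingFamily V) (Disc : Discovery X) (v : V) :
    Set (Finset V) :=
  {Z | (v, Z) ∈ F.tests ∧ ∃ S ∈ F.subsets, ∃ hv : v ∈ S, Z ⊆ S ∧
    ∀ c : Fin 2, ∀ u : S, (u : V) ∈ Z → u ∉ (M.localPDAG Disc S c).definiteDesc ⟨v, hv⟩}

/-- Regime faithfulness on tested witnesses: for tested queries with an admissible witness,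
d-separation from `C` in the augmented graph is conditional independence from `C` under `P*`. -/
def TwoRegimeSCM.RegimeFaithful [∀ v, StandardBorelSpace (X v)] (M : TwoRegimeSCM X)
    (F : TestingFamily V) (Disc : Discovery X) (w : Fin 2 → ℝ≥0) : Prop :=
  ∀ v Z, (v, Z) ∈ F.tests → Z ∈ M.witnesses F Disc v →
    ((M.dag.augment M.targets).DSep none (some v) (some '' (Z : Set V)) ↔
      RegimeCondIndep w M.law v Z)

end Evidence

/-! ### Discriminating paths

A path `⟨v_0, …, v_{m-1}, j, k⟩` is a sequence `p`, of which only the entries `p 0, …, p (m + 1)`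
matter: `p l = v_l` for `l < m`, `p m = j` and `p (m + 1) = k`. Sets of nodes on the path are given
as sets of positions. -/

section Discriminating

variable {W : Type*}

/-- All edges of the path are edges of the skeleton `adj`. -/
def PathIn (adj : W → W → Prop) (m : ℕ) (p : ℕ → W) : Prop :=
  ∀ i ≤ m, adj (p i) (p (i + 1))

/-- `p` is a candidate discriminating path for `(j, k)` in the skeleton `adj`. (As `v_0` and `k` are
not adjacent, `m` is at least `1`.) -/
structure IsCandidatePath (adj : W → W → Prop) (m : ℕ) (p : ℕ → W) : Prop where
  simple : Set.InjOn p (Set.Iic (m + 1))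
  path : PathIn adj m p
  nonadj : ¬ adj (p 0) (p (m + 1))

open Classical in
/-- The local status of `v_l`: whether it is a collider on the path, and whether it is a parent
of `k`. -/
noncomputable def DAG.status (D : DAG W) (m : ℕ) (p : ℕ → W) (l : ℕ) : Bool × Bool :=
  (decide (D.IsColliderAt p l), decide (D.edge (p l) (p (m + 1))))

/-- A replay assignment on the set `R` of (positions of) replay nodes. -/
abbrev ReplayAssignment (R : Finset ℕ) : Type := R → Bool × Bool

/-- `D` has the statuses prescribed by `σ`. -/
def DAG.Realizes (D : DAG W) (m : ℕ) (p : ℕ → W) {R : Finset ℕ} (σ : ReplayAssignment R) : Prop :=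
  ∀ l : R, D.status m p l = σ l

/-- The endpoint mark at `j` of the edge between `j` and `k`. -/
inductive EndMark
  | tail
  | arrowhead

/-- The directed edges `dir` put the given mark at `j` on the edge between `j` and `k`. -/
def HasMark (dir : W → W → Prop) (j k : W) : EndMark → Prop
  | .tail => dir j k
  | .arrowhead => dir k j

/-- Local constraints are given by the set `A` of the graphs that meet them; `σ` is compatible with
the constraints if some graph that meets them has the statuses prescribed by `σ`. -/
def CompatibleReplay (A : Set (DAG W)) (m : ℕ) (p : ℕ → W) {R : Finset ℕ}
    (σ : ReplayAssignment R) : Prop :=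
  ∃ D ∈ A, D.Realizes m p σ

/-- `DP(σ) = μ`: the assignment `σ` is compatible, and together with the constraints it entails the
mark `μ` at `j` on the edge between `j` and `k`. (If `σ` makes all of `v_1, …, v_{m-1}` colliders
and parents of `k`, `m ≥ 2`, then `j → v_{m-1} → k`, and the entailed mark is the tail.) -/
def DPMark (A : Set (DAG W)) (m : ℕ) (p : ℕ → W) {R : Finset ℕ} (σ : ReplayAssignment R)
    (μ : EndMark) : Prop :=
  CompatibleReplay A m p σ ∧
    ∀ D ∈ A, D.Realizes m p σ → HasMark D.edge (p m) (p (m + 1)) μ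

/-- `R` is a sufficient replay-node set: it consists of nodes among `v_1, …, v_{m-1}`, and each
compatible replay assignment on it determines the mark. -/
def SufficientReplay (A : Set (DAG W)) (m : ℕ) (p : ℕ → W) (R : Finset ℕ) : Prop :=
  R ⊆ Finset.Ico 1 m ∧
    ∀ σ : ReplayAssignment R, CompatibleReplay A m p σ → ∃ μ, DPMark A m p σ μ

/-- `DP(σ)` and `DP(σ')` are different marks. -/
def ChangesMark (A : Set (DAG W)) (m : ℕ) (p : ℕ → W) {R : Finset ℕ}
    (σ σ' : ReplayAssignment R) : Prop :=
  ∃ μ μ', DPMark A m p σ μ ∧ DPMark A m p σ' μ' ∧ μ ≠ μ'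

/-- `r` is the first replay node, in the order from `j` to `v_0`, where `σ` and `σ'` disagree. -/
def IsFirstDisagreement {R : Finset ℕ} (σ σ' : ReplayAssignment R) (r : R) : Prop :=
  σ r ≠ σ' r ∧ ∀ l : R, r < l → σ l = σ' l

/-- `v_l` is a collider on the path under `σ`; where `σ` prescribes nothing, the marks of `D`
decide. -/
def ColliderUnder (D : DAG W) (p : ℕ → W) {R : Finset ℕ} (σ : ReplayAssignment R) (l : ℕ) : Prop :=
  (∃ h : l ∈ R, (σ ⟨l, h⟩).1 = true) ∨ (l ∉ R ∧ D.IsColliderAt p l)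

/-- Compatibility of the segment from `v_r` to `j` with the conditioning set `Z`, in a DAG `D` with
intervention targets `I`. -/
structure SegmentCompatible (D : DAG W) (I : Set W) (Z : Set W) (m : ℕ) (p : ℕ → W)
    {R : Finset ℕ} (σ : ReplayAssignment R) (r : ℕ) : Prop where
  /-- The segment is in the skeleton. -/
  present : ∀ l, r ≤ l → l < m → D.Adj (p l) (p (l + 1))
  /-- Under the marks of `σ`, the inner nodes of the segment are unblocked given `Z`. -/
  unblocked : ∀ l, r < l → l < m →
    (D.augment I).Unblocked (some '' Z) (ColliderUnder D p σ l) (some (p l))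
  /-- The edge of the segment next to `j` has a tail at `j`. -/
  tail : D.edge (p m) (p (m - 1))
  not_mem : p m ∉ Z
  /-- If `C` is connected to `j` by an unblocked path, then by one that meets the segment only
  in `j`. -/
  disjoint : (∃ n q, (D.augment I).IsUnblockedPath (some '' Z) none (some (p m)) n q) →
    ∃ n q, (D.augment I).IsUnblockedPath (some '' Z) none (some (p m)) n q ∧
      ∀ i < n, ∀ l, r ≤ l → l ≤ m → q i ≠ some (p l)

end Discriminating

section Local

variable {V : Type*} [Fintype V] [DecidableEq V] {X : V → Type*} [∀ v, MeasurableSpace (X v)]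

/-- The local graphs `G'[S]` of the members `G'` of `[G]_res`: those that are left
by the restricted evidence, including the tested invariances and changes. -/
def localGraphs (Mod : Set (TwoRegimeSCM X)) (F : TestingFamily V) (Disc : Discovery X)
    (G : DAG V) (S : Finset V) : Set (DAG S) :=
  (fun G' => G'.induce S) '' resClass Mod F Disc G

end Local

/-! The proof is by contradiction, propagating a regime change along the path. Suppose a class
member `G'` has a replay assignment whose mark differs from the target mark. Equality of the
Psi-images gives a model with DAG `G'` and the observed evidence. The change at `j` and faithfulness
make `C` d-connected to `j` given `Z` (`dSep_iff_invariant`). Segment compatibility at the first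
disagreement `r` lets this connection continue past `j` along the path to `r`
(`SegmentCompatible.not_dSep`), whereas the invariance observed at `r` forces d-separation there.

So all class members yield the target mark `μ`. Their local graphs lie in `A`, so the edge between
`j` and `k` has mark `μ` in each of them, and the test-induced graph directs it.

The probabilistic bridge is `regimeCondIndep_iff_invariant`: as both regime weights are positive, a
law of `X_v` given `(X_Z, C)` that does not depend on `C` is the same thing as a common version of
the two conditional laws. -/

/-! ### Extending unblocked paths along the segment -/

theorem DAG.not_edge_of_edge {W : Type*} (D : DAG W) {u v : W} (h : D.edge u v) : ¬ D.edge v u :=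
  fun h' => D.acyclic u ((Relation.TransGen.single h).tail h')

/-- Appending to an unblocked path from `a` to `b` a path that leaves `b` through a tail. -/
theorem DAG.IsUnblockedPath.append {W : Type*} {D : DAG W} {Z : Set W} {a b : W} {n : ℕ}
    {q : ℕ → W} (hq : D.IsUnblockedPath Z a b n q) {t : ℕ} {s : ℕ → W} (ht : 0 < t)
    (h0 : s 0 = b) (hinj : Set.InjOn s (Set.Iic t)) (hadj : ∀ i < t, D.Adj (s i) (s (i + 1)))
    (htail : D.edge b (s 1)) (hb : b ∉ Z)
    (hun : ∀ i, 0 < i → i < t → D.Unblocked Z (D.IsColliderAt s i) (s i))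
    (hdisj : ∀ i < n, ∀ l ≤ t, q i ≠ s l) :
    D.IsUnblockedPath Z a (s t) (n + t) (fun i => if i ≤ n then q i else s (i - n)) := by
  -- Both branches of the `if` give `b` at `i = n`, so either formula may be used there.
  have hright : ∀ i, n ≤ i → (if i ≤ n then q i else s (i - n)) = s (i - n) := by
    intro i hi
    split_ifs with h
    · obtain rfl : i = n := le_antisymm h hi
      rw [Nat.sub_self, h0, hq.finish]
    · rfl
  have hleft : ∀ i, i ≤ n → (if i ≤ n then q i else s (i - n)) = q i := fun i hi => if_pos hi
  refine ⟨?_, ?_, ?_, ?_, ?_⟩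
  · simpa using hq.start
  · exact (hright (n + t) (by omega)).trans (by rw [Nat.add_sub_cancel_left])
  · intro i hi l hl h
    simp only [Set.mem_Iic] at hi hl
    dsimp only at h
    rcases lt_or_ge i n with hin | hin <;> rcases lt_or_ge l n with hln | hln
    · rw [hleft i hin.le, hleft l hln.le] at h
      exact hq.simple hin.le hln.le h
    · rw [hleft i hin.le, hright l hln] at h
      exact absurd h (hdisj i hin _ (by omega))
    · rw [hright i hin, hleft l hln.le] at h
      exact absurd h.symm (hdisj l hln _ (by omega))
    · rw [hright i hin, hright l hln] at h
      have := hinj (show i - n ≤ t by omega) (show l - n ≤ t by omega) h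
      omega
  · intro i hi
    rcases lt_or_ge i n with hin | hin
    · rw [hleft i hin.le, hleft (i + 1) hin]
      exact hq.adj i hin
    · rw [hright i hin, hright (i + 1) (by omega), Nat.sub_add_comm hin]
      exact hadj _ (by omega)
  · intro i hi0 hi
    simp only [DAG.IsColliderAt]
    rcases lt_trichotomy i n with hin | rfl | hin
    · rw [hleft i hin.le, hleft (i + 1) hin, hleft (i - 1) (by omega)]
      exact hq.unblocked i hi0 hin
    · rw [hright i le_rfl, hright (i + 1) (by omega), Nat.sub_self, Nat.add_sub_cancel_left, h0]
      -- At the junction the outgoing edge has its tail at `b`, so `b` is a non-collider and `b ∉ Z`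
      -- suffices.
      exact ⟨fun h => absurd h.2 (D.not_edge_of_edge htail), fun _ => hb⟩
    · rw [hright i hin.le, hright (i + 1) (by omega), hright (i - 1) (by omega),
        Nat.sub_add_comm hin.le, Nat.sub_right_comm]
      exact hun _ (by omega) (by omega)

theorem DAG.augment_edge_some {W : Type*} (D : DAG W) (I : Set W) {u v : W} :
    (D.augment I).edge (some u) (some v) ↔ D.edge u v :=
  ⟨fun h => by cases h; assumption, DAG.AugEdge.old⟩

/-- If the segment from `r` to `j` is compatible with `Z` and `C` is d-connected to `j`, then `C` is
d-connected to the node in position `r`. -/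
theorem SegmentCompatible.not_dSep {W : Type*} {D : DAG W} {I Z : Set W} {m : ℕ} {p : ℕ → W}
    {R : Finset ℕ} {σ : ReplayAssignment R} {r : ℕ} (h : SegmentCompatible D I Z m p σ r)
    (hr : r < m) (hp : Set.InjOn p (Set.Iic m))
    (hσ : ∀ l : R, (σ l).1 = true ↔ D.IsColliderAt p l)
    (hj : ¬ (D.augment I).DSep none (some (p m)) (some '' Z)) :
    ¬ (D.augment I).DSep none (some (p r)) (some '' Z) := by
  -- Since `D` carries the collider bits of `σ`, the marks under `σ` are the actual ones.
  have hcol : ∀ l, ColliderUnder D p σ l ↔ D.IsColliderAt p l := by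
    intro l
    by_cases hl : l ∈ R
    · simp [ColliderUnder, hl, hσ]
    · simp [ColliderUnder, hl]
  obtain ⟨n, q, hq, hdisj⟩ := h.disjoint (not_not.mp hj)
  -- The segment is traversed backwards, from `j = p m` down to `p r`.
  have key := hq.append (t := m - r) (s := fun i => some (p (m - i))) (by omega) (by simp)
    ?_ ?_ ?_ ?_ ?_ ?_
  · rw [show m - (m - r) = r by omega] at key
    exact not_not.mpr ⟨_, _, key⟩
  · intro i hi l hl hil
    simp only [Set.mem_Iic] at hi hl
    have := hp (show m - i ≤ m by omega) (show m - l ≤ m by omega) (Option.some.inj hil)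
    omega
  · intro i hi
    have := h.present (m - (i + 1)) (by omega) (by omega)
    rw [show m - (i + 1) + 1 = m - i by omega] at this
    simp only [DAG.Adj, D.augment_edge_some]
    exact this.symm
  · exact (D.augment_edge_some I).2 h.tail
  · rintro ⟨z, hz, hzj⟩
    exact h.not_mem (Option.some.inj hzj ▸ hz)
  · intro i hi0 hi
    have := h.unblocked (m - i) (by omega) (by omega)
    rw [propext (hcol (m - i))] at this
    -- Reversal swaps the two neighbours of a node, which leaves the collider condition unchanged.
    have hc : (D.augment I).IsColliderAt (fun i => some (p (m - i))) i ↔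
        D.IsColliderAt p (m - i) := by
      simp only [DAG.IsColliderAt, D.augment_edge_some]
      rw [show m - (i - 1) = m - i + 1 by omega, show m - (i + 1) = m - i - 1 by omega, and_comm]
    rwa [propext hc]
  · intro i hi l hl
    exact hdisj i hi (m - l) (by omega) (by omega)

/-! ### Invariance as conditional independence from the regime -/

section Mixture

variable {α β Ω : Type*} [MeasurableSpace α] [MeasurableSpace β] [MeasurableSpace Ω]

theorem measurable_insertRegime (c : Fin 2) :
    Measurable (fun z : α × β => ((z.1, c), z.2)) := by fun_prop

theorem map_insertRegime_apply (μ : Measure (α × β)) (c d : Fin 2) {s : Set (α × β)}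
    (hs : MeasurableSet s) :
    μ.map (fun z : α × β => ((z.1, c), z.2))
      {y : (α × Fin 2) × β | y.1.2 = d ∧ (y.1.1, y.2) ∈ s} = if c = d then μ s else 0 := by
  have hm : MeasurableSet {y : (α × Fin 2) × β | y.1.2 = d ∧ (y.1.1, y.2) ∈ s} :=
    (measurableSet_eq_fun (by fun_prop) (by fun_prop)).inter
      ((show Measurable (fun y : (α × Fin 2) × β => (y.1.1, y.2)) by fun_prop) hs)
  rw [Measure.map_apply (measurable_insertRegime c) hm]
  by_cases h : c = d <;> simp [h]

/-- The components of a weighted disjoint union of two measures are determined by the sum. -/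
theorem smul_map_insertRegime_add_inj (w : Fin 2 → ℝ≥0) (hw : ∀ c, 0 < w c)
    (μ ν : Fin 2 → Measure (α × β)) :
    w 0 • (μ 0).map (fun z => ((z.1, (0 : Fin 2)), z.2)) +
        w 1 • (μ 1).map (fun z => ((z.1, (1 : Fin 2)), z.2)) =
      w 0 • (ν 0).map (fun z => ((z.1, (0 : Fin 2)), z.2)) +
        w 1 • (ν 1).map (fun z => ((z.1, (1 : Fin 2)), z.2)) ↔ ∀ c, μ c = ν c := by
  refine ⟨fun h c => ?_, fun h => by rw [h 0, h 1]⟩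
  ext s hs
  -- Evaluation on the slice of regime `c` kills the other summand; the positive finite weight then
  -- cancels.
  have h1 := congrArg
    (fun ρ : Measure ((α × Fin 2) × β) => ρ {y | y.1.2 = c ∧ (y.1.1, y.2) ∈ s}) h
  simp only [Measure.add_apply, Measure.smul_apply, map_insertRegime_apply _ _ _ hs] at h1
  have hw0 : ∀ c, (w c : ENNReal) ≠ 0 := fun c => by simpa using (hw c).ne'
  fin_cases c
  · simpa [ENNReal.smul_def, ENNReal.mul_right_inj (hw0 0) ENNReal.coe_ne_top] using h1
  · simpa [ENNReal.smul_def, ENNReal.mul_right_inj (hw0 1) ENNReal.coe_ne_top] using h1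

theorem map_prodMk_compProd_prodMkRight (μ : Measure Ω) [IsFiniteMeasure μ] {g : Ω → α}
    (hg : Measurable g) (c : Fin 2) (κ : Kernel α β) [IsMarkovKernel κ] :
    (μ.map (fun x => (g x, c))).compProd (κ.prodMkRight (Fin 2)) =
      ((μ.map g).compProd κ).map (fun z => ((z.1, c), z.2)) := by
  ext s hs
  rw [Measure.compProd_apply hs, lintegral_map (Kernel.measurable_kernel_prodMk_left hs)
    (by fun_prop), Measure.map_apply (measurable_insertRegime c) hs,
    Measure.compProd_apply (measurable_insertRegime c hs),
    lintegral_map (Kernel.measurable_kernel_prodMk_left (measurable_insertRegime c hs)) hg]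
  rfl

theorem nnreal_smul_compProd (a : ℝ≥0) (μ : Measure α) [SFinite μ] (κ : Kernel α β)
    [IsSFiniteKernel κ] : (a • μ).compProd κ = a • μ.compProd κ :=
  Measure.compProd_smul_left (a : ENNReal)

end Mixture

theorem mixture_map {V : Type*} {X : V → Type*} [∀ v, MeasurableSpace (X v)]
    {γ : Type*} [MeasurableSpace γ]
    (w : Fin 2 → ℝ≥0) (P : Fin 2 → Measure (∀ v, X v)) {φ : Fin 2 × (∀ v, X v) → γ} (hφ : Measurable φ) :
    (mixture w P).map φ = w 0 • (P 0).map (fun x => φ (0, x)) +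
      w 1 • (P 1).map (fun x => φ (1, x)) := by
  rw [mixture, Measure.map_add _ _ hφ, Measure.map_smul, Measure.map_smul,
    Measure.map_map hφ (by fun_prop), Measure.map_map hφ (by fun_prop)]
  rfl

section Regime

variable {V : Type*} {X : V → Type*} [∀ v, MeasurableSpace (X v)]

/-- Both sides of the mixture identity split into parts carried by the disjoint slices `C = 0` and
`C = 1`, so it can be compared regime by regime. -/
theorem mixture_compProd_iff (w : Fin 2 → ℝ≥0) (hw : ∀ c, 0 < w c)
    (P : Fin 2 → Measure (∀ v, X v)) [∀ c, IsProbabilityMeasure (P c)] (v : V) (Z : Finset V)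
    (κ : Kernel (∀ u : Z, X u) (X v)) [IsMarkovKernel κ] :
    (mixture w P).map (fun y => ((Z.restrict y.2, y.1), y.2 v)) =
        ((mixture w P).map (fun y => (Z.restrict y.2, y.1))).compProd (κ.prodMkRight (Fin 2)) ↔
      ∀ c, (P c).map (fun x => (Z.restrict x, x v)) = ((P c).map Z.restrict).compProd κ := by
  have hZ : Measurable (Z.restrict : (∀ v, X v) → ∀ u : Z, X u) := Finset.measurable_restrict Z
  rw [← smul_map_insertRegime_add_inj w hw, mixture_map w P (by fun_prop),
    mixture_map w P (by fun_prop), Measure.compProd_add_left, nnreal_smul_compProd,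
    nnreal_smul_compProd, map_prodMk_compProd_prodMkRight _ hZ,
    map_prodMk_compProd_prodMkRight _ hZ, Measure.map_map (by fun_prop) (by fun_prop),
    Measure.map_map (by fun_prop) (by fun_prop)]
  rfl

theorem regimeCondIndep_iff_invariant [Fintype V] [DecidableEq V]
    [∀ v, StandardBorelSpace (X v)] [∀ v, Nonempty (X v)]
    (w : Fin 2 → ℝ≥0) (hw : ∀ c, 0 < w c) (P : Fin 2 → Measure (∀ v, X v))
    [∀ c, IsProbabilityMeasure (P c)] (v : V) (Z : Finset V) :
    RegimeCondIndep w P v Z ↔ Invariant P v Z := by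
  have hk : Measurable (fun y : Fin 2 × (∀ v, X v) => (Z.restrict y.2 : ∀ u : Z, X u)) :=
    (Finset.measurable_restrict Z).comp measurable_snd
  have hv : Measurable (fun y : Fin 2 × (∀ v, X v) => y.2 v) :=
    (measurable_pi_apply v).comp measurable_snd
  have hiff := condIndepFun_iff_condDistrib_prod_ae_eq_prodMkRight (μ := mixture w P) hv
    (measurable_fst (α := Fin 2) (β := ∀ v, X v)) hk
  rw [RegimeCondIndep]
  refine hiff.trans ?_
  -- Conditional independence becomes a factorization of the joint law of `((X_Z, C), X_v)` through
  -- a kernel that ignores `C`.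
  rw [condDistrib_ae_eq_iff_measure_eq_compProd _ hv.aemeasurable]
  constructor
  · intro h
    -- The common version is the conditional law of `X_v` given `X_Z` under the mixture.
    exact ⟨_, inferInstance, (mixture_compProd_iff w hw P v Z _).1 h⟩
  · rintro ⟨κ, hκ, h⟩
    have h' := (mixture_compProd_iff w hw P v Z κ).2 h
    -- Averaging the two regimes shows that `κ` also disintegrates the mixture, so it is a.e. the
    -- conditional law given `X_Z`.
    have hZ : (mixture w P).map (fun y => (Z.restrict y.2, y.2 v)) =
        ((mixture w P).map (fun y => Z.restrict y.2)).compProd κ := by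
      rw [mixture_map w P (hk.prodMk hv), mixture_map w P hk, Measure.compProd_add_left,
        nnreal_smul_compProd, nnreal_smul_compProd]
      exact congrArg₂ _ (congrArg _ (h 0)) (congrArg _ (h 1))
    have hae := condDistrib_ae_eq_of_measure_eq_compProd _ hv.aemeasurable hZ
    rw [h']
    refine Measure.compProd_congr ?_
    -- The a.e. equality holds for the law of `X_Z`; it is pulled back to the law of `(X_Z, C)`.
    have hfst : (mixture w P).map (fun y => Z.restrict y.2) =
        ((mixture w P).map (fun y => (Z.restrict y.2, y.1))).map Prod.fst := by
      rw [Measure.map_map measurable_fst (hk.prodMk measurable_fst)]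
      rfl
    rw [hfst] at hae
    filter_upwards [ae_of_ae_map measurable_fst.aemeasurable hae] with z hz
    simpa [Kernel.prodMkRight_apply] using hz.symm

end Regime

/-! ### Marks of the class members -/

theorem HasMark.unique {W : Type*} {D : DAG W} {j k : W} {μ μ' : EndMark}
    (h : HasMark D.edge j k μ) (h' : HasMark D.edge j k μ') : μ = μ' := by
  cases μ <;> cases μ'
  · rfl
  · exact absurd h' (D.not_edge_of_edge h)
  · exact absurd h' (D.not_edge_of_edge h)
  · rfl

theorem DPMark.unique {W : Type*} {A : Set (DAG W)} {m : ℕ} {p : ℕ → W} {R : Finset ℕ}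
    {σ : ReplayAssignment R} {μ μ' : EndMark} (h : DPMark A m p σ μ) (h' : DPMark A m p σ μ') :
    μ = μ' := by
  obtain ⟨D, hD, hσ⟩ := h.1
  exact (h.2 D hD hσ).unique (h'.2 D hD hσ)

theorem exists_isFirstDisagreement {R : Finset ℕ} {σ σ' : ReplayAssignment R} (h : σ ≠ σ') :
    ∃ r, IsFirstDisagreement σ σ' r := by
  classical
  have hne : (Finset.univ.filter fun l : R => σ l ≠ σ' l).Nonempty := by
    obtain ⟨l, hl⟩ := Function.ne_iff.1 h
    exact ⟨l, by simpa using hl⟩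
  -- Positions increase towards `j`, so the first disagreement seen from `j` has the largest index.
  refine ⟨Finset.max' _ hne, (Finset.mem_filter.1 (Finset.max'_mem _ hne)).2, fun l hl => ?_⟩
  by_contra hσ
  exact absurd (Finset.le_max' _ l (by simpa using hσ)) (not_le.2 hl)

/-! ### Transfer of invariances and witnesses between models with the same evidence -/

section Evidence

variable {V : Type*} [Fintype V] [DecidableEq V] {X : V → Type*} [∀ v, MeasurableSpace (X v)]
  {F : TestingFamily V} {Disc : Discovery X}

theorem exists_model_of_mem_resClass {Mod : Set (TwoRegimeSCM X)} {M : TwoRegimeSCM X}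
    (hM : M ∈ Mod) {G' : DAG V} (hG' : G' ∈ resClass Mod F Disc M.dag) :
    ∃ M' ∈ Mod, M'.dag = G' ∧ M'.evidence F Disc = M.evidence F Disc := by
  have h : M.evidence F Disc ∈ psiImage Mod F Disc M.dag := ⟨M, hM, rfl, rfl⟩
  rwa [← show psiImage Mod F Disc G' = psiImage Mod F Disc M.dag from hG'] at h

theorem invariant_iff_of_evidence_eq {M M' : TwoRegimeSCM X}
    (h : M'.evidence F Disc = M.evidence F Disc) {v : V} {Z : Finset V} (hv : (v, Z) ∈ F.tests) :
    Invariant M'.law v Z ↔ Invariant M.law v Z :=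
  iff_of_eq (congrFun (congrArg Prod.snd h) ⟨(v, Z), hv⟩)

theorem witnesses_eq_of_evidence_eq {M M' : TwoRegimeSCM X}
    (h : M'.evidence F Disc = M.evidence F Disc) (v : V) :
    M'.witnesses F Disc v = M.witnesses F Disc v := by
  have hloc : ∀ S ∈ F.subsets, ∀ c, M'.localPDAG Disc S c = M.localPDAG Disc S c :=
    fun S hS c => congrFun (congrFun (congrArg Prod.fst h) ⟨S, hS⟩) c
  ext Z
  refine and_congr_right fun _ => exists_congr fun S => and_congr_right fun hS => ?_
  simp only [hloc S hS]

/-- For a tested query with an admissible witness, d-separation from the regime vertex in a model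
that shares the evidence of `M` is invariance in `M`. -/
theorem dSep_iff_invariant [∀ v, StandardBorelSpace (X v)] [∀ v, Nonempty (X v)]
    {w : Fin 2 → ℝ≥0} (hw : ∀ c, 0 < w c) {M M' : TwoRegimeSCM X}
    (hM' : M'.RegimeFaithful F Disc w) (h : M'.evidence F Disc = M.evidence F Disc)
    {v : V} {Z : Finset V} (hv : (v, Z) ∈ F.tests) (hZ : Z ∈ M.witnesses F Disc v) :
    (M'.dag.augment M'.targets).DSep none (some v) (some '' (Z : Set V)) ↔
      Invariant M.law v Z :=
  (hM' v Z hv (witnesses_eq_of_evidence_eq h v ▸ hZ)).trans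
    ((regimeCondIndep_iff_invariant w hw _ v Z).trans (invariant_iff_of_evidence_eq h hv))

end Evidence

/-! ### The contrastive discriminating path -/

theorem proposition3
    {V : Type*} [Fintype V] [DecidableEq V]
    {X : V → Type*} [∀ v, MeasurableSpace (X v)] [∀ v, StandardBorelSpace (X v)]
    [∀ v, Nonempty (X v)]
    -- admissible testing family, discovery operators, model class, regime weights
    (F : TestingFamily V) (Disc : Discovery X) (Mod : Set (TwoRegimeSCM X))
    (w : Fin 2 → ℝ≥0) (hw : ∀ c, 0 < w c) (hw1 : w 0 + w 1 = 1)
    (hfaith : ∀ M ∈ Mod, M.RegimeFaithful F Disc w)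
    -- the generating model; its DAG is `G`, its laws are `P^(0)` and `P^(1)`
    (M : TwoRegimeSCM X) (hM : M ∈ Mod)
    -- the common candidate discriminating path, with `j = p m` and `k = p (m + 1)`
    (S : Finset V) (hS : S ∈ F.subsets) (m : ℕ) (p : ℕ → S)
    (hpath : ∀ c, IsCandidatePath (M.localPDAG Disc S c).Adj m p)
    (hundir : ∀ c, (M.localPDAG Disc S c).undir (p m) (p (m + 1)))
    -- the ambient local constraints on `S`: the graphs that meet them, among these all `G'[S]`
    (A : Set (DAG S)) (hA : localGraphs Mod F Disc M.dag S ⊆ A)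
    -- the replay nodes and the target replay assignment
    (R : Finset ℕ) (hR : SufficientReplay A m p R)
    (σt : ReplayAssignment R) (hσt : CompatibleReplay A m p σt)
    -- the common tested witness
    (Z : Finset V) (hZS : Z ⊆ S)
    (hZj : ((p m : V), Z) ∈ F.tests) (hZR : ∀ l ∈ R, ((p l : V), Z) ∈ F.tests)
    (hWj : Z ∈ M.witnesses F Disc (p m)) (hWR : ∀ l ∈ R, Z ∈ M.witnesses F Disc (p l))
    (hInv : ∀ l ∈ R, Invariant M.law (p l : V) Z) (hChg : ¬ Invariant M.law (p m : V) Z)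
    -- (i) the path is in the skeleton of every member of the class
    (hskel : ∀ G' ∈ resClass Mod F Disc M.dag, PathIn (G'.induce S).Adj m p)
    -- (ii) for every member of the class that carries an alternative replay assignment: segment
    -- compatibility
    (hseg : ∀ G' ∈ resClass Mod F Disc M.dag, ∀ σ : ReplayAssignment R,
      (G'.induce S).Realizes m p σ →
      ChangesMark A m p σ σt →
      ∀ r : R, IsFirstDisagreement σ σt r →
      ∀ M' ∈ Mod, M'.dag = G' → M'.evidence F Disc = M.evidence F Disc →
        SegmentCompatible G' M'.targets (Z : Set V) m (fun l => (p l : V)) σ r) :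
    ∃! μ : EndMark,
      -- it is the target mark, and the only mark of replay assignments left by the evidence
      DPMark A m p σt μ ∧
      (∀ σ : ReplayAssignment R, CompatibleReplay (localGraphs Mod F Disc M.dag S) m p σ →
        ∀ μ', DPMark A m p σ μ' ↔ μ' = μ) ∧
      (∀ G' ∈ resClass Mod F Disc M.dag,
        HasMark (G'.induce S).edge (p m) (p (m + 1)) μ) ∧
      HasMark (testGraph Mod F Disc M.dag).dir (p m : V) (p (m + 1) : V) μ := by
  obtain ⟨μ, hμ⟩ := hR.2 σt hσt
  have hclass : ∀ G' ∈ resClass Mod F Disc M.dag, ∀ σ : ReplayAssignment R,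
      (G'.induce S).Realizes m p σ → DPMark A m p σ μ := by
    intro G' hG' σ hσ
    obtain ⟨μ', hμ'⟩ := hR.2 σ ⟨_, hA ⟨G', hG', rfl⟩, hσ⟩
    by_cases hne : μ' = μ
    · exact hne ▸ hμ'
    exfalso
    have hσne : σ ≠ σt := by
      rintro rfl
      exact hne (hμ'.unique hμ)
    obtain ⟨r, hr⟩ := exists_isFirstDisagreement hσne
    obtain ⟨M', hM', rfl, hev⟩ := exists_model_of_mem_resClass hM hG'
    have hcompat := hseg _ hG' σ hσ ⟨μ', μ, hμ', hμ, hne⟩ r hr M' hM' rfl hev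
    have hinj : Set.InjOn (fun l => (p l : V)) (Set.Iic m) := fun a ha b hb hab =>
      (hpath 0).simple (Set.Iic_subset_Iic.2 m.le_succ ha) (Set.Iic_subset_Iic.2 m.le_succ hb)
        (Subtype.ext hab)
    -- The change at `j` opens a path from `C` to `r`, while the invariance at `r` closes all such
    -- paths.
    refine hcompat.not_dSep (Finset.mem_Ico.1 (hR.1 r.2)).2 hinj (fun l => ?_)
      (fun h => hChg ((dSep_iff_invariant hw (hfaith M' hM') hev hZj hWj).1 h))
      ((dSep_iff_invariant hw (hfaith M' hM') hev (hZR r r.2) (hWR r r.2)).2 (hInv r r.2))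
    classical
    -- Edges of `G'[S]` are by definition edges of `G'`, so collider status on the path is the same
    -- in both.
    rw [← hσ l, DAG.status]
    exact decide_eq_true_iff
  have hmark : ∀ G' ∈ resClass Mod F Disc M.dag,
      HasMark (G'.induce S).edge (p m) (p (m + 1)) μ := fun G' hG' =>
    -- `hclass` is applied to the assignment read off from `G'[S]` itself, which `G'[S]` realizes
    -- trivially.
    (hclass G' hG' (fun l => (G'.induce S).status m p l) fun _ => rfl).2 _
      (hA ⟨G', hG', rfl⟩) fun _ => rfl
  refine ⟨μ, ⟨hμ, ?_, hmark, ?_⟩, fun μ' h => h.1.unique hμ⟩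
  · rintro σ ⟨_, ⟨G', hG', rfl⟩, hσ⟩ μ'
    have := hclass G' hG' σ hσ
    exact ⟨fun h => h.unique this, fun h => h ▸ this⟩
  · cases μ
    · exact fun G' hG' => hmark G' hG'
    · exact fun G' hG' => hmark G' hG'
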